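/- **Setting.** Let $\mathscr{L}$ be a many-sorted first-order language and $\mathfrak{M}$ an infinite $\mathscr{L}$-structure that is $\kappa$-saturated and strongly $\kappa$-homogeneous, where $\kappa>|\mathscr{L}|$ is a strong limit cardinal ($|\mathscr L|$ is the number of $\mathscr L$-formulas). *Small* means of cardinality $<\kappa$. A set of finite tuples of $\mathfrak M$ is $\bigwedge$-*definable* (over a small set $B$ of elements of $\mathfrak M$) if it is the set of realisations of a partial type over $B$. A *hyperdefinable set* is a quotient $P=X/E$ of a non-empty $\bigwedge$-definable set $X$ of finite tuples by an $\bigwedge$-definable equivalence relation $E$ on $X$. Parameters are small sets $A$ consisting of a set $A_{\mathrm{re}}$ of elements of $\mathfrak M$ together with elements of hyperdefinable sets $Y/F$ with $Y,F$ $\bigwedge$-definable over $A_{\mathrm{re}}$ (hyperimaginaries over $A_{\mathrm{re}}$); $\mathrm{Aut}(\mathfrak M/A)$ is the group of automorphisms of $\mathfrak M$ that fix every element of $A$. A set of tuples is $A$-*invariant* if it is setwise invariant under $\mathrm{Aut}(\mathfrak M/A)$, and $\bigwedge_A$-*definable* if it is $\bigwedge$-definable and $A$-invariant. $P=X/E$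 is $A$-*hyperdefinable* if $X$ and $E$ are $A$-invariant; subsets of $P$, and relations between $A$-hyperdefinable sets, are $\bigwedge_A$-definable if their preimages (sets of tuples) are so. A *piecewise $A$-hyperdefinable set* is a direct limit $P=\varinjlim_{i\in I}P_i$ of $A$-hyperdefinable sets, over a non-empty directed ordered set $I$ of cofinality $<\kappa$, along injective $\bigwedge_A$-definable transition maps. The images of the $P_i$ in $P$ are the *pieces* (identified with the $P_i$); $P$ is *countably* piecewise hyperdefinable if $I$ has countable cofinality. A subset of $P$ (or of a finite product of such sets, with the products of pieces as pieces) is *piecewise $\bigwedge_A$-definable* if its intersection with every piece is $\bigwedge_A$-definable. The *$A$-logic topology* of $P$ is the topology whose closed sets are the piecewise $\bigwedge_A$-definable subsets of $P$. A *logic topology* of $P$ is the $A$-logic topology for some small $A$ over which $P$ is piecewise hyperdefinable; there is at most one $T_1$ logic topology on $P$, and if it exists it is called the *global logic topology* of $P$. $P$ is *locally hyperdefinable* if for some such $A$ every point of $P$ has a piece that is a neighbourhood of it in the $A$-logic topology. A *piecewise hyperdefinable group* is a group whose universe is, for some small $A$, a piecewise $A$-hyperdefinable set and whose multiplication and inversion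 have piecewise $\bigwedge_A$-definable graphs and are piecewise bounded (the image of a piece, resp. of a product of two pieces, is contained in a piece). A *locally hyperdefinable group* is a piecewise hyperdefinable group whose universe is locally hyperdefinable. Topological groups are Hausdorff by convention. **Theorem.** Let $G$ be a piecewise hyperdefinable group. 1. If $G$ is locally hyperdefinable and has a global logic topology, then $G$ with its global logic topology is a locally compact topological group. 2. Suppose that $G$ is countably piecewise hyperdefinable and let $\mathcal T$ be any logic topology of $G$. Then $G$ with $\mathcal T$ is a locally compact topological group if and only if $\mathcal T$ is the global logic topology of $G$ and $G$ is locally hyperdefinable. -/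

import Mathlib

open Cardinal

universe u v w

/-! ### Many-sorted first-order logic -/

/-- A many-sorted first-order language. A function symbol has a list of argument sorts and a value
sort (constants have the empty list), a relation symbol has a list of argument sorts. -/
structure SortedLanguage where
  Sorts : Type u
  Functions : List Sorts → Sorts → Type u
  Relations : List Sorts → Type u

namespace SortedLanguage

/-- Terms with variables indexed by `α`, the variable `a` having sort `σ a`. -/
inductive Term (L : SortedLanguage.{u}) {α : Type v} (σ : α → L.Sorts) : L.Sorts → Type (max u v)
  | var (a : α) : Term L σ (σ a)
  | func {Γ : List L.Sorts} {s : L.Sorts} (f : L.Functions Γ s)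
      (ts : ∀ i : Fin Γ.length, Term L σ (Γ.get i)) : Term L σ s

/-- Formulas with free variables indexed by `α` (of sorts `σ`) and a list `Δ` of sorts for the
variables that are still to be bound. The quantifier binds the head of the list. -/
inductive BFormula (L : SortedLanguage.{u}) {α : Type v} (σ : α → L.Sorts) :
    List L.Sorts → Type (max u v)
  | falsum {Δ : List L.Sorts} : BFormula L σ Δ
  | equal {Δ : List L.Sorts} {s : L.Sorts} (t₁ t₂ : L.Term (Sum.elim σ Δ.get) s) : BFormula L σ Δ
  | rel {Δ Γ : List L.Sorts} (R : L.Relations Γ)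
      (ts : ∀ i : Fin Γ.length, L.Term (Sum.elim σ Δ.get) (Γ.get i)) : BFormula L σ Δ
  | imp {Δ : List L.Sorts} (φ ψ : BFormula L σ Δ) : BFormula L σ Δ
  | all {Δ : List L.Sorts} (s : L.Sorts) (φ : BFormula L σ (s :: Δ)) : BFormula L σ Δ

/-- Formulas with free variables indexed by `α`. -/
abbrev Formula (L : SortedLanguage.{u}) {α : Type v} (σ : α → L.Sorts) : Type (max u v) :=
  L.BFormula σ []

/-- The cardinality of a language: the number of its formulas (in finitely many variables). -/
def card (L : SortedLanguage.{u}) : Cardinal.{u} :=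
  #(Σ (n : ℕ) (σ : Fin n → L.Sorts), L.Formula σ)

end SortedLanguage

/-- A many-sorted structure. -/
structure SortedStructure (L : SortedLanguage.{u}) where
  carrier : L.Sorts → Type u
  funMap : ∀ {Γ : List L.Sorts} {s : L.Sorts}, L.Functions Γ s →
    (∀ i : Fin Γ.length, carrier (Γ.get i)) → carrier s
  relMap : ∀ {Γ : List L.Sorts}, L.Relations Γ →
    (∀ i : Fin Γ.length, carrier (Γ.get i)) → Prop

namespace SortedStructure

variable {L : SortedLanguage.{u}} (M : SortedStructure L)

/-- Single elements of the structure, with their sort. -/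
abbrev Elem : Type u := Σ s : L.Sorts, M.carrier s

/-- Tuples of elements of the sorts `σ`. -/
abbrev Tuple {α : Type v} (σ : α → L.Sorts) : Type (max u v) := ∀ a, M.carrier (σ a)

variable {M}

/-- Value of a term. -/
def termVal {α : Type v} {σ : α → L.Sorts} (x : M.Tuple σ) :
    ∀ {s : L.Sorts}, L.Term σ s → M.carrier s
  | _, .var a => x a
  | _, .func f ts => M.funMap f fun i => termVal x (ts i)

/-- The tuple on a disjoint union of two index types. -/
def pairTuple {α : Type v} {β : Type w} {σ : α → L.Sorts} {τ : β → L.Sorts}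
    (x : M.Tuple σ) (y : M.Tuple τ) : M.Tuple (Sum.elim σ τ)
  | .inl a => x a
  | .inr b => y b

/-- Put a new element in front of a tuple. -/
def consTuple {s : L.Sorts} {Δ : List L.Sorts} (m : M.carrier s) (y : M.Tuple Δ.get) :
    M.Tuple (s :: Δ).get :=
  Fin.cons (α := fun i : Fin (Δ.length + 1) => M.carrier ((s :: Δ).get i)) m y

/-- Satisfaction. -/
def RealizeB {α : Type v} {σ : α → L.Sorts} (x : M.Tuple σ) :
    ∀ {Δ : List L.Sorts}, L.BFormula σ Δ → M.Tuple Δ.get → Prop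
  | _, .falsum, _ => False
  | _, .equal t₁ t₂, y => termVal (pairTuple x y) t₁ = termVal (pairTuple x y) t₂
  | _, .rel R ts, y => M.relMap R fun i => termVal (pairTuple x y) (ts i)
  | _, .imp φ ψ, y => RealizeB x φ y → RealizeB x ψ y
  | _, .all s φ, y => ∀ m : M.carrier s, RealizeB x φ (consTuple m y)

/-- Satisfaction of a formula by a tuple. -/
def Realize {α : Type v} {σ : α → L.Sorts} (φ : L.Formula σ) (x : M.Tuple σ) : Prop :=
  RealizeB x φ fun i => i.elim0

/-! ### Definable and infinitely definable sets of tuples -/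

/-- The set `D` of tuples is definable by a formula with parameters in `B`. -/
def DefinableOver (B : Set M.Elem) {α : Type v} {σ : α → L.Sorts} (D : Set (M.Tuple σ)) : Prop :=
  ∃ φ : L.Formula (Sum.elim σ fun b : B => b.1.1),
    D = {x | Realize φ (pairTuple x fun b : B => b.1.2)}

/-- The set `V` of tuples is defined by a partial type with parameters in `B`. -/
def TypeDefinableOver (B : Set M.Elem) {α : Type v} {σ : α → L.Sorts} (V : Set (M.Tuple σ)) :
    Prop :=
  ∃ 𝓕 : Set (Set (M.Tuple σ)), (∀ D ∈ 𝓕, DefinableOver B D) ∧ V = ⋂₀ 𝓕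

/-- The set `V` is defined by a partial type over some small (of size `< κ`) set of parameters. -/
def TypeDefinable (κ : Cardinal.{u}) {α : Type v} {σ : α → L.Sorts} (V : Set (M.Tuple σ)) : Prop :=
  ∃ B : Set M.Elem, #B < κ ∧ TypeDefinableOver B V

/-! ### Saturation and homogeneity -/

variable (M)

/-- `κ`-saturation: finitely satisfiable families of formulas in finitely many variables, over
fewer than `κ` parameters, are satisfiable. -/
def Saturated (κ : Cardinal.{u}) : Prop :=
  ∀ B : Set M.Elem, #B < κ → ∀ (α : Type) [Finite α] (σ : α → L.Sorts) (𝓕 : Set (Set (M.Tuple σ))),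
    (∀ D ∈ 𝓕, DefinableOver B D) →
    (∀ 𝓕₀ ⊆ 𝓕, 𝓕₀.Finite → (⋂₀ 𝓕₀).Nonempty) → (⋂₀ 𝓕).Nonempty

/-- Automorphisms of a structure. -/
structure Aut where
  toEquiv : ∀ s, M.carrier s ≃ M.carrier s
  map_fun : ∀ {Γ : List L.Sorts} {s : L.Sorts} (f : L.Functions Γ s) (x : M.Tuple Γ.get),
    toEquiv s (M.funMap f x) = M.funMap f fun i => toEquiv _ (x i)
  map_rel : ∀ {Γ : List L.Sorts} (R : L.Relations Γ) (x : M.Tuple Γ.get),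
    M.relMap R (fun i => toEquiv _ (x i)) ↔ M.relMap R x

variable {M} in
/-- The action of an automorphism on tuples. -/
def Aut.app (g : M.Aut) {α : Type v} {σ : α → L.Sorts} (x : M.Tuple σ) : M.Tuple σ :=
  fun a => g.toEquiv _ (x a)

/-- Strong `κ`-homogeneity: a partial elementary map between subsets with fewer than `κ` elements
(given by enumerations `x` and `y` of its domain and its image) extends to an automorphism. -/
def StronglyHomogeneous (κ : Cardinal.{u}) : Prop :=
  ∀ (J : Type u), #J < κ → ∀ (σ : J → L.Sorts) (x y : M.Tuple σ),
    (∀ φ : L.Formula σ, Realize φ x ↔ Realize φ y) → ∃ g : M.Aut, g.app x = y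

end SortedStructure

open SortedStructure

/-! ### Hyperdefinable sets -/

/-- A hyperdefinable set `X / E`: `X` is a non-empty infinitely definable set of finite tuples and
`E` an infinitely definable equivalence relation on it, over small sets of parameters. -/
structure HyperdefinableSet {L : SortedLanguage.{u}} (M : SortedStructure L) (κ : Cardinal.{u}) where
  arity : ℕ
  sort : Fin arity → L.Sorts
  X : Set (M.Tuple sort)
  nonempty : X.Nonempty
  E : Setoid X
  typeDefinable_X : TypeDefinable κ X
  typeDefinable_E : TypeDefinable κ
    {z : M.Tuple (Sum.elim sort sort) | ∃ x y : X, E x y ∧ z = pairTuple x.1 y.1}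

namespace HyperdefinableSet

variable {L : SortedLanguage.{u}} {M : SortedStructure L} {κ : Cardinal.{u}}

/-- The underlying set `X / E`. -/
def Carrier (P : HyperdefinableSet M κ) : Type u := Quotient P.E

/-- The graph of `E`. -/
def graphE (P : HyperdefinableSet M κ) : Set (M.Tuple (Sum.elim P.sort P.sort)) :=
  {z | ∃ x y : P.X, P.E x y ∧ z = pairTuple x.1 y.1}

/-- The tuple `x` is a representative of `a`. -/
def Rep (P : HyperdefinableSet M κ) (x : M.Tuple P.sort) (a : P.Carrier) : Prop :=
  ∃ h : x ∈ P.X, (Quotient.mk P.E ⟨x, h⟩ : Quotient P.E) = a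

/-- Preimage in `X` of a subset of `X / E`. -/
def pre (P : HyperdefinableSet M κ) (V : Set P.Carrier) : Set (M.Tuple P.sort) :=
  {x | ∃ a ∈ V, P.Rep x a}

/-- Preimage of a relation between two hyperdefinable sets. -/
def pre₂ (P Q : HyperdefinableSet M κ) (R : P.Carrier → Q.Carrier → Prop) :
    Set (M.Tuple (Sum.elim P.sort Q.sort)) :=
  {z | ∃ x y a b, z = pairTuple x y ∧ P.Rep x a ∧ Q.Rep y b ∧ R a b}

/-- Preimage of a relation between three hyperdefinable sets. -/
def pre₃ (P Q S : HyperdefinableSet M κ) (R : P.Carrier → Q.Carrier → S.Carrier → Prop) :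
    Set (M.Tuple (Sum.elim (Sum.elim P.sort Q.sort) S.sort)) :=
  {z | ∃ x y w a b c, z = pairTuple (pairTuple x y) w ∧
    P.Rep x a ∧ Q.Rep y b ∧ S.Rep w c ∧ R a b c}

end HyperdefinableSet

/-! ### Hyperimaginary parameters -/

/-- A small set `A` of parameters: a small set `re` of real elements, and a small set `hyp` of
elements of `re`-hyperdefinable sets. A hyperimaginary is recorded as an equivalence class of
tuples. -/
structure Params {L : SortedLanguage.{u}} (M : SortedStructure L) (κ : Cardinal.{u}) where
  re : Set M.Elem
  hyp : Set (Σ (n : ℕ) (σ : Fin n → L.Sorts), Set (M.Tuple σ))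
  small_re : #re < κ
  small_hyp : #hyp < κ
  over_re : ∀ h ∈ hyp, ∃ (P : HyperdefinableSet M κ) (a : P.Carrier),
    TypeDefinableOver re P.X ∧ TypeDefinableOver re P.graphE ∧
      h = ⟨P.arity, P.sort, {x | P.Rep x a}⟩

namespace Params

variable {L : SortedLanguage.{u}} {M : SortedStructure L} {κ : Cardinal.{u}}

/-- The automorphism `g` is in `Aut(M/A)`: it fixes the real elements of `A` and maps each
hyperimaginary in `A` to itself. -/
def FixedBy (A : Params M κ) (g : M.Aut) : Prop :=
  (∀ b ∈ A.re, g.toEquiv b.1 b.2 = b.2) ∧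
    ∀ h ∈ A.hyp, (fun x : M.Tuple h.2.1 => g.app x) '' h.2.2 = h.2.2

/-- `A`-invariance: setwise invariance under `Aut(M/A)`. -/
def Invariant (A : Params M κ) {α : Type v} {σ : α → L.Sorts} (V : Set (M.Tuple σ)) : Prop :=
  ∀ g : M.Aut, A.FixedBy g → ∀ x ∈ V, g.app x ∈ V

/-- Infinitely definable over `A`: infinitely definable (over some small set of real parameters)
and `A`-invariant. -/
def TypeDef (A : Params M κ) {α : Type v} {σ : α → L.Sorts} (V : Set (M.Tuple σ)) : Prop :=
  TypeDefinable κ V ∧ A.Invariant V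

end Params

/-! ### Piecewise hyperdefinable sets -/

/-- A direct system, with injective transition maps and cofinality `< κ`, of hyperdefinable sets.
The parameters over which it is hyperdefinable are dealt with in `IsOver`. -/
structure PiecewiseSystem {L : SortedLanguage.{u}} (M : SortedStructure L) (κ : Cardinal.{u}) where
  I : Type u
  [preorder : Preorder I]
  [directed : IsDirectedOrder I]
  [nonempty : Nonempty I]
  cof_lt : Order.cof I < κ
  piece : I → HyperdefinableSet M κ
  map : ∀ i j : I, i ≤ j → ((piece i).Carrier ↪ (piece j).Carrier)
  [system : DirectedSystem (fun i => (piece i).Carrier) fun i j h => map i j h]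

attribute [instance] PiecewiseSystem.preorder PiecewiseSystem.directed PiecewiseSystem.nonempty
  PiecewiseSystem.system

namespace PiecewiseSystem

variable {L : SortedLanguage.{u}} {M : SortedStructure L} {κ : Cardinal.{u}}

/-- The direct limit. -/
def Carrier (P : PiecewiseSystem M κ) : Type u :=
  DirectLimit (fun i => (P.piece i).Carrier) P.map

/-- The canonical inclusions of the pieces. -/
def incl (P : PiecewiseSystem M κ) (i : P.I) (a : (P.piece i).Carrier) : P.Carrier :=
  (⟦⟨i, a⟩⟧ : DirectLimit (fun i => (P.piece i).Carrier) P.map)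

/-- The pieces, as subsets of the direct limit. -/
def pieceSet (P : PiecewiseSystem M κ) (i : P.I) : Set P.Carrier := Set.range (P.incl i)

/-- `P` is piecewise `A`-hyperdefinable: the pieces are `A`-hyperdefinable and the transition maps
are infinitely definable over `A`. -/
def IsOver (P : PiecewiseSystem M κ) (A : Params M κ) : Prop :=
  (∀ i, A.TypeDef (P.piece i).X ∧ A.TypeDef (P.piece i).graphE) ∧
    ∀ i j (h : i ≤ j), A.TypeDef ((P.piece i).pre₂ (P.piece j) fun a b => P.map i j h a = b)

/-- Piecewise infinitely `A`-definable subsets. -/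
def PiecewiseTypeDef (P : PiecewiseSystem M κ) (A : Params M κ) (V : Set P.Carrier) : Prop :=
  ∀ i, A.TypeDef ((P.piece i).pre (P.incl i ⁻¹' V))

/-- `P` is piecewise `A`-hyperdefinable and `t` is its `A`-logic topology: the closed sets are the
piecewise infinitely `A`-definable subsets. -/
def IsLogicTopologyOver (P : PiecewiseSystem M κ) (A : Params M κ) (t : TopologicalSpace P.Carrier) :
    Prop :=
  P.IsOver A ∧ ∀ V : Set P.Carrier, @IsClosed P.Carrier t V ↔ P.PiecewiseTypeDef A V

/-- `t` is a logic topology of `P` (over some small set of parameters). -/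
def IsLogicTopology (P : PiecewiseSystem M κ) (t : TopologicalSpace P.Carrier) : Prop :=
  ∃ A : Params M κ, P.IsLogicTopologyOver A t

/-- `t` is the global logic topology of `P`, i.e. its `T₁` logic topology. -/
def IsGlobalLogicTopology (P : PiecewiseSystem M κ) (t : TopologicalSpace P.Carrier) : Prop :=
  P.IsLogicTopology t ∧ @T1Space P.Carrier t

/-- `P` is locally hyperdefinable: for some small set `A` of parameters, every point has a piece
that is a neighbourhood of it in the `A`-logic topology. -/
def IsLocallyHyperdefinable (P : PiecewiseSystem M κ) : Prop :=
  ∃ t : TopologicalSpace P.Carrier, P.IsLogicTopology t ∧ ∀ p, ∃ i, P.pieceSet i ∈ @nhds _ t p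

/-- `P` has countable cofinality. -/
def IsCountablyPiecewise (P : PiecewiseSystem M κ) : Prop := Order.cof P.I ≤ ℵ₀

/-- A group law on `P` makes it a piecewise hyperdefinable group: for some small set `A` of
parameters, `P` is piecewise `A`-hyperdefinable and the group operations are piecewise bounded and
piecewise infinitely `A`-definable. -/
def IsHyperdefinableGroup (P : PiecewiseSystem M κ) [Group P.Carrier] : Prop :=
  ∃ A : Params M κ, P.IsOver A ∧
    (∀ i j k, A.TypeDef ((P.piece i).pre₃ (P.piece j) (P.piece k)
      fun a b c => P.incl i a * P.incl j b = P.incl k c)) ∧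
    (∀ i j, ∃ k, ∀ g ∈ P.pieceSet i, ∀ h ∈ P.pieceSet j, g * h ∈ P.pieceSet k) ∧
    (∀ i j, A.TypeDef ((P.piece i).pre₂ (P.piece j) fun a b => (P.incl i a)⁻¹ = P.incl j b)) ∧
    ∀ i, ∃ j, ∀ g ∈ P.pieceSet i, g⁻¹ ∈ P.pieceSet j

end PiecewiseSystem

/-- `G` with the topology `t` is a locally compact (Hausdorff) topological group. -/
def IsLocallyCompactTopologicalGroup (G : Type u) [Group G] (t : TopologicalSpace G) : Prop :=
  @T2Space G t ∧ @IsTopologicalGroup G t _ ∧ @LocallyCompactSpace G t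

/-! Saturation and strong homogeneity make infinitely definable sets stable under projection, and
they make a set invariant over a small real set `C` infinitely definable over `C`
(`typeDefinableOver_proj`). Hence images and preimages under infinitely definable relations between
hyperdefinable sets stay infinitely definable.

In a `T₁` logic topology over `A` the points are closed, so `Aut(M/A)` fixes every class. Every
piecewise infinitely definable subset, over any small parameters, is then closed
(`isClosed_of_typeDefinable`). So the global topology is the finest logic topology, neighbourhoods
in another logic topology remain neighbourhoods in it, and the parameters of the group law need not
be those of the topology. Pieces are closed, and compact by saturation.

For the first statement, inversion is continuous because the preimage of a closed set is a
projection of the graph intersected with that set. For multiplication at `(g, h)`, choose pieces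
that are neighbourhoods of `g` and `h`; their product lies in one piece. The relation "the product
lies off the open set `O`" is infinitely definable and misses `(g, h)`, so by compactness a box of
open sets around `(g, h)` misses it (`exists_box`). A `T₁` topological group is Hausdorff, and
compact pieces that are neighbourhoods then give local compactness.

For the second statement, a Hausdorff logic topology is `T₁`, hence global. Countably many closed
pieces cover the group, so by Baire one of them has an interior point, and translations carry this
to every point. The converse is the first statement. -/

namespace SortedLanguage

/-! ### Substitution of terms and its semantics. -/

variable {L : SortedLanguage.{u}}

/-- Substitution of terms for variables in a term. -/
def Term.subst {α : Type v} {σ : α → L.Sorts} {β : Type w} {τ : β → L.Sorts}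
    (v : ∀ a, L.Term τ (σ a)) : ∀ {s : L.Sorts}, L.Term σ s → L.Term τ s
  | _, .var a => v a
  | _, .func f ts => .func f fun i => (ts i).subst v

/-- Extension of a substitution by the identity on the bound variables. -/
def liftSubst {α : Type v} {σ : α → L.Sorts} {β : Type w} {τ : β → L.Sorts}
    (v : ∀ a, L.Term τ (σ a)) (Δ : List L.Sorts) :
    ∀ a, L.Term (Sum.elim τ Δ.get) (Sum.elim σ Δ.get a)
  | .inl a => (v a).subst fun b => Term.var (σ := Sum.elim τ Δ.get) (.inl b)
  | .inr i => Term.var (σ := Sum.elim τ Δ.get) (.inr i)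

/-- Substitution of terms for the free variables of a formula. -/
def BFormula.subst {α : Type v} {σ : α → L.Sorts} {β : Type w} {τ : β → L.Sorts}
    (v : ∀ a, L.Term τ (σ a)) : ∀ {Δ : List L.Sorts}, L.BFormula σ Δ → L.BFormula τ Δ
  | _, .falsum => .falsum
  | Δ, .equal t₁ t₂ => .equal (t₁.subst (liftSubst v Δ)) (t₂.subst (liftSubst v Δ))
  | Δ, .rel R ts => .rel R fun i => (ts i).subst (liftSubst v Δ)
  | _, .imp φ ψ => .imp (φ.subst v) (ψ.subst v)
  | _, .all s φ => .all s (φ.subst v)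

end SortedLanguage

namespace SortedStructure

open SortedLanguage

variable {L : SortedLanguage.{u}} {M : SortedStructure L} {κ : Cardinal.{u}}

theorem termVal_subst {α : Type v} {σ : α → L.Sorts} {β : Type w} {τ : β → L.Sorts}
    (v : ∀ a, L.Term τ (σ a)) (x : M.Tuple τ) {s : L.Sorts} (t : L.Term σ s) :
    termVal x (t.subst v) = termVal (fun a => termVal x (v a)) t := by
  induction t with
  | var a => rfl
  | func f ts ih => simp only [Term.subst, termVal, ih]

theorem termVal_liftSubst {α : Type v} {σ : α → L.Sorts} {β : Type w} {τ : β → L.Sorts}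
    (v : ∀ a, L.Term τ (σ a)) (x : M.Tuple τ) {Δ : List L.Sorts} (y : M.Tuple Δ.get) :
    (fun a => termVal (pairTuple x y) (liftSubst v Δ a)) =
      pairTuple (fun a => termVal x (v a)) y := by
  funext a
  rcases a with a | i
  · exact termVal_subst _ _ _
  · rfl

/-- Variable capture cannot occur: bound variables are indexed by `Δ`, apart from the free ones, so
the same `v` serves under a quantifier. -/
theorem realizeB_subst {α : Type v} {σ : α → L.Sorts} {β : Type w} {τ : β → L.Sorts}
    (v : ∀ a, L.Term τ (σ a)) (x : M.Tuple τ) {Δ : List L.Sorts} (φ : L.BFormula σ Δ)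
    (y : M.Tuple Δ.get) :
    RealizeB x (φ.subst v) y ↔ RealizeB (fun a => termVal x (v a)) φ y := by
  induction φ with
  | falsum => rfl
  | equal t₁ t₂ => simp only [BFormula.subst, RealizeB, termVal_subst, termVal_liftSubst]
  | rel R ts => simp only [BFormula.subst, RealizeB, termVal_subst, termVal_liftSubst]
  | imp φ ψ ih₁ ih₂ => simp only [BFormula.subst, RealizeB, ih₁, ih₂]
  | all s φ ih => simp only [BFormula.subst, RealizeB, ih]

theorem realize_subst {α : Type v} {σ : α → L.Sorts} {β : Type w} {τ : β → L.Sorts}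
    (v : ∀ a, L.Term τ (σ a)) (x : M.Tuple τ) (φ : L.Formula σ) :
    Realize (φ.subst v) x ↔ Realize φ fun a => termVal x (v a) :=
  realizeB_subst v x φ _

/-! ### Pairs of tuples and projections. -/

section Pairs

variable {α : Type v} {σ : α → L.Sorts} {β : Type w} {τ : β → L.Sorts}

/-- First component of a pair of tuples. -/
def fstTuple (z : M.Tuple (Sum.elim σ τ)) : M.Tuple σ := fun a => z (.inl a)

/-- Second component of a pair of tuples. -/
def sndTuple (z : M.Tuple (Sum.elim σ τ)) : M.Tuple τ := fun b => z (.inr b)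

theorem fstTuple_pairTuple (x : M.Tuple σ) (y : M.Tuple τ) : fstTuple (pairTuple x y) = x := rfl

theorem sndTuple_pairTuple (x : M.Tuple σ) (y : M.Tuple τ) : sndTuple (pairTuple x y) = y := rfl

theorem pairTuple_fstTuple_sndTuple (z : M.Tuple (Sum.elim σ τ)) :
    pairTuple (fstTuple z) (sndTuple z) = z := by
  funext a
  rcases a with a | a <;> rfl

theorem pairTuple_inj {x x' : M.Tuple σ} {y y' : M.Tuple τ} :
    pairTuple x y = pairTuple x' y' ↔ x = x' ∧ y = y' :=
  ⟨fun h => ⟨congrArg fstTuple h, congrArg sndTuple h⟩, fun h => h.1 ▸ h.2 ▸ rfl⟩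

/-- Projection of a set of pairs of tuples to the first component. -/
def proj (W : Set (M.Tuple (Sum.elim σ τ))) : Set (M.Tuple σ) := {x | ∃ y, pairTuple x y ∈ W}

end Pairs

/-! ### Automorphisms -/

namespace Aut

theorem termVal_app (g : M.Aut) {α : Type v} {σ : α → L.Sorts} (x : M.Tuple σ) {s : L.Sorts}
    (t : L.Term σ s) : termVal (g.app x) t = g.toEquiv s (termVal x t) := by
  induction t with
  | var a => rfl
  | func f ts ih => simp only [termVal, ih, g.map_fun]

theorem app_pairTuple (g : M.Aut) {α : Type v} {σ : α → L.Sorts} {β : Type w} {τ : β → L.Sorts}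
    (x : M.Tuple σ) (y : M.Tuple τ) :
    g.app (pairTuple x y) = pairTuple (g.app x) (g.app y) := by
  funext a
  rcases a with a | a <;> rfl

theorem app_consTuple (g : M.Aut) {s : L.Sorts} {Δ : List L.Sorts} (m : M.carrier s)
    (y : M.Tuple Δ.get) : g.app (consTuple m y) = consTuple (g.toEquiv s m) (g.app y) := by
  funext i
  refine Fin.cases ?_ (fun i => ?_) i <;> rfl

theorem realizeB_app (g : M.Aut) {α : Type v} {σ : α → L.Sorts} (x : M.Tuple σ)
    {Δ : List L.Sorts} (φ : L.BFormula σ Δ) (y : M.Tuple Δ.get) :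
    RealizeB (g.app x) φ (g.app y) ↔ RealizeB x φ y := by
  induction φ with
  | falsum => rfl
  | equal t₁ t₂ => simp only [RealizeB, ← app_pairTuple, termVal_app, EmbeddingLike.apply_eq_iff_eq]
  | rel R ts => simp only [RealizeB, ← app_pairTuple, termVal_app, g.map_rel]
  | imp φ ψ ih₁ ih₂ => simp only [RealizeB, ih₁, ih₂]
  | all s φ ih =>
    simp only [RealizeB]
    -- As `g` is bijective on each sort, the quantifier may range over the images `g m`.
    rw [← (g.toEquiv s).forall_congr_right]
    simp only [← app_consTuple, ih]

theorem realize_app (g : M.Aut) {α : Type v} {σ : α → L.Sorts} (x : M.Tuple σ)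
    (φ : L.Formula σ) : Realize φ (g.app x) ↔ Realize φ x := by
  have h := g.realizeB_app x φ fun i => i.elim0
  have h₀ : (g.app fun i => i.elim0 : M.Tuple ([] : List L.Sorts).get) = fun i => i.elim0 :=
    funext fun i => i.elim0
  rwa [h₀] at h

/-- The inverse of an automorphism. -/
def symm (g : M.Aut) : M.Aut where
  toEquiv s := (g.toEquiv s).symm
  map_fun f x := by
    rw [Equiv.symm_apply_eq, g.map_fun]
    simp
  map_rel R x := by
    rw [← g.map_rel]
    simp

theorem app_symm_app (g : M.Aut) {α : Type v} {σ : α → L.Sorts} (x : M.Tuple σ) :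
    g.app (g.symm.app x) = x := by
  funext a
  simp [app, symm]

/-- The automorphism `g` fixes the set `C` of elements pointwise. -/
def Fixes (g : M.Aut) (C : Set M.Elem) : Prop := ∀ b ∈ C, g.toEquiv b.1 b.2 = b.2

theorem Fixes.mono {g : M.Aut} {B C : Set M.Elem} (h : g.Fixes C) (hBC : B ⊆ C) : g.Fixes B :=
  fun b hb => h b (hBC hb)

theorem Fixes.symm {g : M.Aut} {C : Set M.Elem} (h : g.Fixes C) : g.symm.Fixes C := fun b hb => by
  simp only [Aut.symm, Equiv.symm_apply_eq]
  exact (h b hb).symm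

end Aut

/-! ### Definable sets -/

section Definable

variable {B C : Set M.Elem} {α : Type v} {σ : α → L.Sorts} {β : Type w} {τ : β → L.Sorts}

theorem DefinableOver.compl {D : Set (M.Tuple σ)} (hD : DefinableOver B D) :
    DefinableOver B Dᶜ := by
  obtain ⟨φ, rfl⟩ := hD
  exact ⟨.imp φ .falsum, rfl⟩

theorem DefinableOver.inter {D D' : Set (M.Tuple σ)} (hD : DefinableOver B D)
    (hD' : DefinableOver B D') : DefinableOver B (D ∩ D') := by
  obtain ⟨φ, rfl⟩ := hD
  obtain ⟨ψ, rfl⟩ := hD'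
  refine ⟨.imp (.imp φ (.imp ψ .falsum)) .falsum, ?_⟩
  ext x
  simp only [Set.mem_inter_iff, Set.mem_ofPred_eq, Realize, RealizeB]
  tauto

theorem DefinableOver.univ : DefinableOver B (Set.univ : Set (M.Tuple σ)) :=
  ⟨.imp .falsum .falsum, by ext x; simp [Realize, RealizeB]⟩

/-- The coordinates of the map `F` are given by terms with parameters in `C`. -/
def IsTermMap (C : Set M.Elem) (F : M.Tuple σ → M.Tuple τ) : Prop :=
  ∀ b, ∃ t : L.Term (Sum.elim σ fun c : C => c.1.1) (τ b),
    ∀ x, F x b = termVal (pairTuple x fun c : C => c.1.2) t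

theorem IsTermMap.id : IsTermMap C (fun x : M.Tuple σ => x) := fun b =>
  ⟨.var (σ := Sum.elim σ fun c : C => c.1.1) (.inl b), fun _ => rfl⟩

theorem IsTermMap.fst {γ : Type*} {ρ : γ → L.Sorts} {F : M.Tuple ρ → M.Tuple (Sum.elim σ τ)}
    (hF : IsTermMap C F) : IsTermMap C (fun z => fstTuple (F z)) := fun a => hF (.inl a)

theorem IsTermMap.snd {γ : Type*} {ρ : γ → L.Sorts} {F : M.Tuple ρ → M.Tuple (Sum.elim σ τ)}
    (hF : IsTermMap C F) : IsTermMap C (fun z => sndTuple (F z)) := fun a => hF (.inr a)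

theorem IsTermMap.const {y : M.Tuple τ} (hy : ∀ b, (⟨τ b, y b⟩ : M.Elem) ∈ C) :
    IsTermMap C (fun _ : M.Tuple σ => y) := fun b =>
  ⟨.var (σ := Sum.elim σ fun c : C => c.1.1) (.inr ⟨_, hy b⟩), fun _ => rfl⟩

theorem IsTermMap.pair {γ : Type*} {ρ : γ → L.Sorts} {F : M.Tuple σ → M.Tuple τ}
    {G : M.Tuple σ → M.Tuple ρ} (hF : IsTermMap C F) (hG : IsTermMap C G) :
    IsTermMap C (fun x => pairTuple (F x) (G x)) := by
  rintro (b | c)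
  · exact hF b
  · exact hG c

/-- Substituting the terms of `F` into a defining formula covers all changes of variables at once:
projecting, permuting coordinates, plugging in parameters, enlarging the parameter set. -/
theorem DefinableOver.preimage {D : Set (M.Tuple τ)} (hD : DefinableOver B D) (hBC : B ⊆ C)
    {F : M.Tuple σ → M.Tuple τ} (hF : IsTermMap C F) : DefinableOver C (F ⁻¹' D) := by
  obtain ⟨φ, rfl⟩ := hD
  choose t ht using hF
  let v : ∀ a, L.Term (Sum.elim σ fun c : C => c.1.1) (Sum.elim τ (fun c : B => c.1.1) a) :=
    fun a => match a with
    | .inl b => t b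
    | .inr c => .var (σ := Sum.elim σ fun c : C => c.1.1) (.inr ⟨c.1, hBC c.2⟩)
  refine ⟨φ.subst v, ?_⟩
  ext x
  simp only [Set.mem_preimage, Set.mem_ofPred_eq, realize_subst]
  refine iff_of_eq (congrArg _ (funext fun a => ?_))
  rcases a with b | c
  · exact ht b x
  · rfl

theorem TypeDefinableOver.preimage {V : Set (M.Tuple τ)} (hV : TypeDefinableOver B V)
    (hBC : B ⊆ C) {F : M.Tuple σ → M.Tuple τ} (hF : IsTermMap C F) :
    TypeDefinableOver C (F ⁻¹' V) := by
  obtain ⟨𝓕, h𝓕, rfl⟩ := hV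
  refine ⟨(F ⁻¹' ·) '' 𝓕, ?_, ?_⟩
  · rintro _ ⟨D, hD, rfl⟩
    exact (h𝓕 D hD).preimage hBC hF
  · ext x
    simp

theorem TypeDefinableOver.mono {V : Set (M.Tuple σ)} (hV : TypeDefinableOver B V) (hBC : B ⊆ C) :
    TypeDefinableOver C V :=
  hV.preimage hBC .id

theorem DefinableOver.typeDefinableOver {D : Set (M.Tuple σ)} (hD : DefinableOver B D) :
    TypeDefinableOver B D :=
  ⟨{D}, by simpa using hD, by simp⟩

theorem TypeDefinableOver.inter {V W : Set (M.Tuple σ)} (hV : TypeDefinableOver B V)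
    (hW : TypeDefinableOver B W) : TypeDefinableOver B (V ∩ W) := by
  obtain ⟨𝓕, h𝓕, rfl⟩ := hV
  obtain ⟨𝓖, h𝓖, rfl⟩ := hW
  exact ⟨𝓕 ∪ 𝓖, fun D hD => hD.elim (h𝓕 D) (h𝓖 D), Set.sInter_union 𝓕 𝓖 |>.symm⟩

theorem TypeDefinableOver.app_mem {V : Set (M.Tuple σ)} (hV : TypeDefinableOver B V) {g : M.Aut}
    (hg : g.Fixes B) {x : M.Tuple σ} (hx : x ∈ V) : g.app x ∈ V := by
  obtain ⟨𝓕, h𝓕, rfl⟩ := hV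
  intro D hD
  obtain ⟨φ, rfl⟩ := h𝓕 D hD
  have hx := hx _ hD
  rw [Set.mem_ofPred_eq, ← g.realize_app, g.app_pairTuple] at hx
  have hb : (g.app fun b : B => b.1.2) = fun b : B => b.1.2 := funext fun b => hg b.1 b.2
  rwa [hb] at hx

theorem TypeDefinable.preimage {V : Set (M.Tuple τ)} (hV : TypeDefinable κ V)
    {F : M.Tuple σ → M.Tuple τ} (hF : ∀ C : Set M.Elem, IsTermMap C F) :
    TypeDefinable κ (F ⁻¹' V) := by
  obtain ⟨B, hB, hV⟩ := hV
  exact ⟨B, hB, hV.preimage subset_rfl (hF B)⟩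

theorem small_union (hκ : ℵ₀ ≤ κ) (hB : #B < κ) (hC : #C < κ) : #(B ∪ C : Set M.Elem) < κ :=
  (mk_union_le B C).trans_lt (add_lt_of_lt hκ hB hC)

theorem TypeDefinable.inter (hκ : ℵ₀ ≤ κ) {V W : Set (M.Tuple σ)} (hV : TypeDefinable κ V)
    (hW : TypeDefinable κ W) : TypeDefinable κ (V ∩ W) := by
  obtain ⟨B, hB, hV⟩ := hV
  obtain ⟨C, hC, hW⟩ := hW
  exact ⟨B ∪ C, small_union hκ hB hC,
    (hV.mono Set.subset_union_left).inter (hW.mono Set.subset_union_right)⟩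

end Definable

/-! ### Consequences of saturation and homogeneity -/

section Saturation

variable {α : Type} [Finite α] {σ : α → L.Sorts}

/-- Compactness for partial types instead of formulas: finitely many formulas involve only finitely
many of the `V i`. Only the parameter set has to be small, not the index type. -/
theorem Saturated.nonempty_iInter (hsat : M.Saturated κ) {C : Set M.Elem} (hC : #C < κ)
    {ι : Type*} {V : ι → Set (M.Tuple σ)} (hV : ∀ i, TypeDefinableOver C (V i))
    (hne : ∀ s : Finset ι, (⋂ i ∈ s, V i).Nonempty) : (⋂ i, V i).Nonempty := by
  classical
  choose 𝓕 h𝓕 hV𝓕 using hV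
  obtain ⟨x, hx⟩ := hsat C hC α σ (⋃ i, 𝓕 i) (by simpa using fun D i hD => h𝓕 i D hD) (by
    intro 𝓕₀ h₀ hfin
    have := hfin.fintype
    have : ∀ D : 𝓕₀, ∃ i, D.1 ∈ 𝓕 i := fun D => by simpa using h₀ D.2
    choose f hf using this
    obtain ⟨x, hx⟩ := hne (Finset.univ.image f)
    refine ⟨x, fun D hD => ?_⟩
    have hxD : x ∈ V (f ⟨D, hD⟩) := by
      simp only [Set.mem_iInter] at hx
      exact hx _ (Finset.mem_image_of_mem f (Finset.mem_univ _))
    rw [hV𝓕] at hxD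
    exact hxD D (hf ⟨D, hD⟩))
  refine ⟨x, Set.mem_iInter.2 fun i => ?_⟩
  rw [hV𝓕]
  exact fun D hD => hx D (Set.mem_iUnion.2 ⟨i, hD⟩)

theorem Saturated.nonempty_iInter_of_directed (hsat : M.Saturated κ) {C : Set M.Elem}
    (hC : #C < κ) {ι : Type*} [Nonempty ι] {V : ι → Set (M.Tuple σ)}
    (hV : ∀ i, TypeDefinableOver C (V i)) (hdir : Directed (· ⊇ ·) V)
    (hne : ∀ i, (V i).Nonempty) : (⋂ i, V i).Nonempty := by
  refine hsat.nonempty_iInter hC hV fun s => ?_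
  obtain ⟨i, hi⟩ := hdir.finset_le s
  exact (hne i).mono (Set.subset_iInter₂ hi)

/-- Homogeneity is applied to `x` and `y` extended by an enumeration of `C`, which forces the
automorphism to fix `C`. One implication suffices because definable sets are closed under
complement. -/
theorem StronglyHomogeneous.exists_app_eq (hhom : M.StronglyHomogeneous κ) (hκ : ℵ₀ ≤ κ)
    {C : Set M.Elem} (hC : #C < κ) {x y : M.Tuple σ}
    (h : ∀ D, DefinableOver C D → x ∈ D → y ∈ D) : ∃ g : M.Aut, g.Fixes C ∧ g.app x = y := by
  have hJ : #(α ⊕ C) < κ := by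
    rw [mk_sum]
    refine add_lt_of_lt hκ ?_ (by simpa using hC)
    exact (lift_lt_aleph0.2 (lt_aleph0_of_finite α)).trans_le hκ
  obtain ⟨g, hg⟩ := hhom (α ⊕ C) hJ _ (pairTuple x fun c : C => c.1.2)
    (pairTuple y fun c : C => c.1.2) fun φ => ⟨h _ ⟨φ, rfl⟩, fun hy => by
      by_contra hx
      exact h _ (DefinableOver.compl ⟨φ, rfl⟩) hx hy⟩
  exact ⟨g, fun c hc => congrFun hg (.inr ⟨c, hc⟩), funext fun a => congrFun hg (.inl a)⟩

/-- A projection of an infinitely definable set that is invariant under the automorphisms fixing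
the small set `C` is infinitely definable over `C`. -/
theorem typeDefinableOver_proj (hκ : ℵ₀ ≤ κ) (hsat : M.Saturated κ)
    (hhom : M.StronglyHomogeneous κ) {β : Type} [Finite β] {τ : β → L.Sorts} {W : Set (M.Tuple (Sum.elim σ τ))} (hW : TypeDefinable κ W)
    {C : Set M.Elem} (hC : #C < κ)
    (hinv : ∀ g : M.Aut, g.Fixes C → ∀ x ∈ proj W, g.app x ∈ proj W) :
    TypeDefinableOver C (proj W) := by
  obtain ⟨B, hB, hW⟩ := hW
  refine ⟨{D | DefinableOver C D ∧ proj W ⊆ D}, fun D hD => hD.1, ?_⟩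
  refine subset_antisymm (fun x hx D hD => hD.2 hx) fun x hx => ?_
  -- `𝓓` is the type of `x` over `C`. It is consistent with `W`, so some point of `proj W` has the
  -- same type as `x`, and homogeneity together with invariance moves it to `x`.
  let 𝓓 := {D : Set (M.Tuple σ) // DefinableOver C D ∧ x ∈ D}
  have : Nonempty 𝓓 := ⟨⟨Set.univ, .univ, trivial⟩⟩
  obtain ⟨z, hz⟩ := hsat.nonempty_iInter_of_directed (C := C ∪ B) (small_union hκ hC hB)
    (ι := 𝓓) (V := fun D => fstTuple ⁻¹' D.1 ∩ W)
    (fun D => (D.2.1.typeDefinableOver.preimage Set.subset_union_left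
      IsTermMap.id.fst).inter (hW.mono Set.subset_union_right))
    (fun D D' => ⟨⟨D.1 ∩ D'.1, D.2.1.inter D'.2.1, D.2.2, D'.2.2⟩,
      fun z hz => ⟨hz.1.1, hz.2⟩, fun z hz => ⟨hz.1.2, hz.2⟩⟩)
    (fun D => by
      by_contra hemp
      refine hx D.1ᶜ ⟨D.2.1.compl, fun x' ⟨y, hy⟩ hD => hemp ⟨pairTuple x' y, hD, hy⟩⟩ D.2.2)
  rw [Set.mem_iInter] at hz
  have hzW : fstTuple z ∈ proj W := by
    refine ⟨sndTuple z, ?_⟩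
    rw [pairTuple_fstTuple_sndTuple]
    exact (hz (Classical.arbitrary 𝓓)).2
  obtain ⟨g, hg, hgx⟩ := hhom.exists_app_eq hκ hC (x := fstTuple z) (y := x) fun D hD hzD => by
    by_contra hxD
    exact (hz ⟨Dᶜ, hD.compl, hxD⟩).1 hzD
  exact hgx ▸ hinv g hg _ hzW

theorem TypeDefinable.proj (hκ : ℵ₀ ≤ κ) (hsat : M.Saturated κ)
    (hhom : M.StronglyHomogeneous κ) {β : Type} [Finite β] {τ : β → L.Sorts} {W : Set (M.Tuple (Sum.elim σ τ))} (hW : TypeDefinable κ W) :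
    TypeDefinable κ (proj W) := by
  obtain ⟨B, hB, hW'⟩ := hW
  refine ⟨B, hB, typeDefinableOver_proj hκ hsat hhom ⟨B, hB, hW'⟩ hB ?_⟩
  rintro g hg x ⟨y, hy⟩
  exact ⟨g.app y, g.app_pairTuple x y ▸ hW'.app_mem hg hy⟩

/-- `V` is its own projection along the empty tuple, so `typeDefinableOver_proj` exchanges the
original parameters for `C`. -/
theorem TypeDefinable.typeDefinableOver (hκ : ℵ₀ ≤ κ) (hsat : M.Saturated κ)
    (hhom : M.StronglyHomogeneous κ) {V : Set (M.Tuple σ)} (hV : TypeDefinable κ V)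
    {C : Set M.Elem} (hC : #C < κ) (hinv : ∀ g : M.Aut, g.Fixes C → ∀ x ∈ V, g.app x ∈ V) :
    TypeDefinableOver C V := by
  let τ : Empty → L.Sorts := Empty.elim
  have h : SortedStructure.proj (fstTuple (τ := τ) ⁻¹' V) = V := by
    ext x
    exact ⟨fun ⟨_, h⟩ => h, fun h => ⟨fun e => e.elim, h⟩⟩
  rw [← h]
  exact typeDefinableOver_proj hκ hsat hhom (hV.preimage fun _ => IsTermMap.id.fst) hC (h.symm ▸ hinv)

end Saturation

end SortedStructure

/-! ### Hyperdefinable sets: representatives, infinitely definable relations, separation by boxes.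
-/

namespace HyperdefinableSet

variable {L : SortedLanguage.{u}} {M : SortedStructure L} {κ : Cardinal.{u}}

theorem exists_rep (P : HyperdefinableSet M κ) (a : P.Carrier) : ∃ x, P.Rep x a := by
  obtain ⟨⟨x, hx⟩, rfl⟩ := Quotient.exists_rep a
  exact ⟨x, hx, rfl⟩

variable {P Q S : HyperdefinableSet M κ}

theorem Rep.unique {x : M.Tuple P.sort} {a b : P.Carrier} (ha : P.Rep x a) (hb : P.Rep x b) :
    a = b := by
  obtain ⟨_, rfl⟩ := ha
  obtain ⟨_, rfl⟩ := hb
  rfl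

theorem Rep.mem_pre_iff {x : M.Tuple P.sort} {a : P.Carrier} (ha : P.Rep x a)
    {V : Set P.Carrier} : x ∈ P.pre V ↔ a ∈ V :=
  ⟨fun ⟨_, hb, hxb⟩ => ha.unique hxb ▸ hb, fun h => ⟨a, h, ha⟩⟩

theorem mem_pre_singleton_iff {x : M.Tuple P.sort} {a : P.Carrier} :
    x ∈ P.pre {a} ↔ P.Rep x a :=
  ⟨fun ⟨_, hb, hx⟩ => Set.mem_singleton_iff.1 hb ▸ hx, fun h => ⟨a, rfl, h⟩⟩

theorem pre_univ : P.pre Set.univ = P.X :=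
  Set.ext fun _ => ⟨fun ⟨_, _, hx, _⟩ => hx, fun hx => ⟨_, trivial, hx, rfl⟩⟩

theorem pairTuple_mem_graphE_iff {x y : M.Tuple P.sort} :
    pairTuple x y ∈ P.graphE ↔ ∃ a, P.Rep x a ∧ P.Rep y a := by
  constructor
  · rintro ⟨x', y', hE, h⟩
    obtain ⟨rfl, rfl⟩ := pairTuple_inj.1 h
    exact ⟨_, ⟨x'.2, rfl⟩, y'.2, (Quotient.sound hE).symm⟩
  · rintro ⟨_, ⟨hx, rfl⟩, hy, h⟩
    exact ⟨⟨x, hx⟩, ⟨y, hy⟩, Quotient.exact h.symm, rfl⟩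

theorem pairTuple_mem_pre₂_iff {R : P.Carrier → Q.Carrier → Prop} {x : M.Tuple P.sort}
    {y : M.Tuple Q.sort} :
    pairTuple x y ∈ P.pre₂ Q R ↔ ∃ a b, P.Rep x a ∧ Q.Rep y b ∧ R a b := by
  constructor
  · rintro ⟨x', y', a, b, h, ha, hb, hR⟩
    obtain ⟨rfl, rfl⟩ := pairTuple_inj.1 h
    exact ⟨a, b, ha, hb, hR⟩
  · rintro ⟨a, b, ha, hb, hR⟩
    exact ⟨x, y, a, b, rfl, ha, hb, hR⟩

theorem pairTuple_mem_pre₃_iff {R : P.Carrier → Q.Carrier → S.Carrier → Prop}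
    {x : M.Tuple P.sort} {y : M.Tuple Q.sort} {w : M.Tuple S.sort} :
    pairTuple (pairTuple x y) w ∈ P.pre₃ Q S R ↔
      ∃ a b c, P.Rep x a ∧ Q.Rep y b ∧ S.Rep w c ∧ R a b c := by
  constructor
  · rintro ⟨x', y', w', a, b, c, h, ha, hb, hc, hR⟩
    obtain ⟨h₁, rfl⟩ := pairTuple_inj.1 h
    obtain ⟨rfl, rfl⟩ := pairTuple_inj.1 h₁
    exact ⟨a, b, c, ha, hb, hc, hR⟩
  · rintro ⟨a, b, c, ha, hb, hc, hR⟩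
    exact ⟨x, y, w, a, b, c, rfl, ha, hb, hc, hR⟩

theorem typeDefinable_pre_singleton (hκ : ℵ₀ ≤ κ) (a : P.Carrier) :
    TypeDefinable κ (P.pre {a}) := by
  obtain ⟨x, hx⟩ := P.exists_rep a
  obtain ⟨B, hB, hE⟩ := P.typeDefinable_E
  let C : Set M.Elem := Set.range fun i => ⟨P.sort i, x i⟩
  have hC : #C < κ := (Set.finite_range _).lt_aleph0.trans_le hκ
  refine ⟨B ∪ C, small_union hκ hB hC, ?_⟩
  have hxC : ∀ i, (⟨P.sort i, x i⟩ : M.Elem) ∈ B ∪ C := fun i => Or.inr ⟨i, rfl⟩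
  convert hE.preimage Set.subset_union_left ((IsTermMap.const hxC).pair IsTermMap.id) using 1
  ext y
  rw [mem_pre_singleton_iff]
  refine ⟨fun hy => pairTuple_mem_graphE_iff.2 ⟨a, hx, hy⟩, fun h => ?_⟩
  obtain ⟨b, hb, hy⟩ := pairTuple_mem_graphE_iff.1 h
  exact hx.unique hb ▸ hy

section Saturation

variable (hκ : ℵ₀ ≤ κ) (hsat : M.Saturated κ) (hhom : M.StronglyHomogeneous κ)
include hκ hsat hhom

theorem typeDefinable_pre_exists {R : P.Carrier → Q.Carrier → Prop}
    (hR : TypeDefinable κ (P.pre₂ Q R)) {V : Set Q.Carrier} (hV : TypeDefinable κ (Q.pre V)) :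
    TypeDefinable κ (P.pre {a | ∃ b ∈ V, R a b}) := by
  convert (hR.inter hκ (hV.preimage fun _ => IsTermMap.id.snd)).proj hκ hsat hhom using 1
  ext x
  constructor
  · rintro ⟨a, ⟨b, hb, hab⟩, hx⟩
    obtain ⟨y, hy⟩ := Q.exists_rep b
    exact ⟨y, pairTuple_mem_pre₂_iff.2 ⟨a, b, hx, hy, hab⟩, b, hb, hy⟩
  · rintro ⟨y, hxy, hy⟩
    obtain ⟨a, b, ha, hb, hab⟩ := pairTuple_mem_pre₂_iff.1 hxy
    exact ⟨a, ⟨b, hb.mem_pre_iff.1 hy, hab⟩, ha⟩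

theorem typeDefinable_pre_exists_left {R : P.Carrier → Q.Carrier → Prop}
    (hR : TypeDefinable κ (P.pre₂ Q R)) {V : Set P.Carrier} (hV : TypeDefinable κ (P.pre V)) :
    TypeDefinable κ (Q.pre {b | ∃ a ∈ V, R a b}) := by
  refine typeDefinable_pre_exists hκ hsat hhom (R := fun b a => R a b) ?_ hV
  convert hR.preimage fun C => (IsTermMap.id (σ := Sum.elim Q.sort P.sort)).snd.pair
    IsTermMap.id.fst using 1
  ext z
  rw [← pairTuple_fstTuple_sndTuple z, pairTuple_mem_pre₂_iff, Set.mem_preimage,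
    fstTuple_pairTuple, sndTuple_pairTuple, pairTuple_mem_pre₂_iff]
  exact ⟨fun ⟨a, b, h₁, h₂, h⟩ => ⟨b, a, h₂, h₁, h⟩, fun ⟨a, b, h₁, h₂, h⟩ => ⟨b, a, h₂, h₁, h⟩⟩

theorem typeDefinable_pre₂_exists {R : P.Carrier → Q.Carrier → S.Carrier → Prop}
    (hR : TypeDefinable κ (P.pre₃ Q S R)) {V : Set S.Carrier} (hV : TypeDefinable κ (S.pre V)) :
    TypeDefinable κ (P.pre₂ Q fun a b => ∃ c ∈ V, R a b c) := by
  convert (hR.inter hκ (hV.preimage fun _ => IsTermMap.id.snd)).proj hκ hsat hhom using 1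
  ext z
  rw [← pairTuple_fstTuple_sndTuple z, pairTuple_mem_pre₂_iff]
  constructor
  · rintro ⟨a, b, ha, hb, c, hc, hR⟩
    obtain ⟨w, hw⟩ := S.exists_rep c
    exact ⟨w, pairTuple_mem_pre₃_iff.2 ⟨a, b, c, ha, hb, hw, hR⟩, c, hc, hw⟩
  · rintro ⟨w, hz, hw⟩
    obtain ⟨a, b, c, ha, hb, hc, hR⟩ := pairTuple_mem_pre₃_iff.1 hz
    exact ⟨a, b, ha, hb, c, hc.mem_pre_iff.1 hw, hR⟩

/-- A definable `D` need not be a union of classes. The complement of this set consists of the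
classes lying wholly inside `D`, and serves as a basic open set. -/
theorem typeDefinable_pre_exists_notMem {D : Set (M.Tuple P.sort)} {C : Set M.Elem} (hC : #C < κ)
    (hD : DefinableOver C D) : TypeDefinable κ (P.pre {a | ∃ x, P.Rep x a ∧ x ∉ D}) := by
  have hD' : TypeDefinable κ Dᶜ := ⟨C, hC, hD.compl.typeDefinableOver⟩
  have hE : TypeDefinable κ P.graphE := P.typeDefinable_E
  convert (hE.inter hκ (hD'.preimage fun _ => IsTermMap.id.snd)).proj hκ hsat hhom
    using 1
  ext z
  constructor
  · rintro ⟨a, ⟨x, hx, hxD⟩, hz⟩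
    have hzx : pairTuple z x ∈ P.graphE := pairTuple_mem_graphE_iff.2 ⟨a, hz, hx⟩
    exact ⟨x, hzx, hxD⟩
  · rintro ⟨x, hzx, hxD⟩
    obtain ⟨a, hz, hx⟩ := pairTuple_mem_graphE_iff.1 hzx
    exact ⟨a, ⟨x, hx, hxD⟩, hz⟩

/-- A point off an infinitely definable relation lies in a box, with infinitely definable
complements of the sides, that misses the relation. -/
theorem exists_box {R : P.Carrier → Q.Carrier → Prop} (hR : TypeDefinable κ (P.pre₂ Q R))
    {a : P.Carrier} {b : Q.Carrier} (hab : ¬ R a b) :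
    ∃ (V : Set P.Carrier) (W : Set Q.Carrier), TypeDefinable κ (P.pre V) ∧
      TypeDefinable κ (Q.pre W) ∧ a ∉ V ∧ b ∉ W ∧ ∀ a' b', R a' b' → a' ∈ V ∨ b' ∈ W := by
  obtain ⟨B₁, hB₁, 𝓕, h𝓕, ha𝓕⟩ := P.typeDefinable_pre_singleton hκ a
  obtain ⟨B₂, hB₂, 𝓖, h𝓖, hb𝓖⟩ := Q.typeDefinable_pre_singleton hκ b
  obtain ⟨B₃, hB₃, hR⟩ := hR
  let 𝓓 := {D : Set (M.Tuple P.sort) // DefinableOver B₁ D ∧ P.pre {a} ⊆ D} ×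
    {D : Set (M.Tuple Q.sort) // DefinableOver B₂ D ∧ Q.pre {b} ⊆ D}
  have : Nonempty 𝓓 :=
    ⟨⟨Set.univ, .univ, Set.subset_univ _⟩, Set.univ, .univ, Set.subset_univ _⟩
  -- If every definable box around the two classes met the relation, saturation would give related
  -- representatives of `a` and `b`.
  obtain ⟨D, hD⟩ : ∃ D : 𝓓, ∀ x ∈ D.1.1, ∀ y ∈ D.2.1, pairTuple x y ∉ P.pre₂ Q R := by
    by_contra! hcon
    obtain ⟨z, hz⟩ := hsat.nonempty_iInter_of_directed (C := B₁ ∪ B₂ ∪ B₃)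
      (small_union hκ (small_union hκ hB₁ hB₂) hB₃) (ι := 𝓓)
      (V := fun D => fstTuple ⁻¹' D.1.1 ∩ sndTuple ⁻¹' D.2.1 ∩ P.pre₂ Q R)
      (fun D => ((D.1.2.1.typeDefinableOver.preimage
          (Set.subset_union_left.trans Set.subset_union_left) IsTermMap.id.fst).inter
          (D.2.2.1.typeDefinableOver.preimage
            (Set.subset_union_right.trans Set.subset_union_left) IsTermMap.id.snd)).inter
        (hR.mono Set.subset_union_right))
      (fun D D' => ⟨⟨⟨D.1.1 ∩ D'.1.1, D.1.2.1.inter D'.1.2.1, Set.subset_inter D.1.2.2 D'.1.2.2⟩,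
          ⟨D.2.1 ∩ D'.2.1, D.2.2.1.inter D'.2.2.1, Set.subset_inter D.2.2.2 D'.2.2.2⟩⟩,
        fun z hz => ⟨⟨hz.1.1.1, hz.1.2.1⟩, hz.2⟩, fun z hz => ⟨⟨hz.1.1.2, hz.1.2.2⟩, hz.2⟩⟩)
      (fun D => by
        obtain ⟨x, hx, y, hy, hxy⟩ := hcon D
        exact ⟨pairTuple x y, ⟨hx, hy⟩, hxy⟩)
    rw [Set.mem_iInter] at hz
    have hx : fstTuple z ∈ P.pre {a} := by
      rw [ha𝓕]
      refine fun D hD => (hz ⟨⟨D, h𝓕 D hD, ?_⟩, (Classical.arbitrary 𝓓).2⟩).1.1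
      exact ha𝓕 ▸ Set.sInter_subset_of_mem hD
    have hy : sndTuple z ∈ Q.pre {b} := by
      rw [hb𝓖]
      refine fun D hD => (hz ⟨(Classical.arbitrary 𝓓).1, ⟨D, h𝓖 D hD, ?_⟩⟩).1.2
      exact hb𝓖 ▸ Set.sInter_subset_of_mem hD
    have hzR := (hz (Classical.arbitrary 𝓓)).2
    rw [← pairTuple_fstTuple_sndTuple z] at hzR
    obtain ⟨a', b', ha', hb', hR'⟩ := pairTuple_mem_pre₂_iff.1 hzR
    rw [(mem_pre_singleton_iff.1 hx).unique ha', (mem_pre_singleton_iff.1 hy).unique hb'] at hab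
    exact hab hR'
  refine ⟨_, _, typeDefinable_pre_exists_notMem hκ hsat hhom hB₁ D.1.2.1,
    typeDefinable_pre_exists_notMem hκ hsat hhom hB₂ D.2.2.1, ?_, ?_, ?_⟩
  · rintro ⟨x, hx, hxD⟩
    exact hxD (D.1.2.2 (mem_pre_singleton_iff.2 hx))
  · rintro ⟨y, hy, hyD⟩
    exact hyD (D.2.2.2 (mem_pre_singleton_iff.2 hy))
  · intro a' b' hR'
    obtain ⟨x, hx⟩ := P.exists_rep a'
    obtain ⟨y, hy⟩ := Q.exists_rep b'
    by_contra! hcon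
    refine hD x ?_ y ?_ (pairTuple_mem_pre₂_iff.2 ⟨a', b', hx, hy, hR'⟩)
    · by_contra hxD
      exact hcon.1 ⟨x, hx, hxD⟩
    · by_contra hyD
      exact hcon.2 ⟨y, hy, hyD⟩

end Saturation

end HyperdefinableSet

/-! ### Real representatives of hyperimaginary parameters. -/

namespace Params

variable {L : SortedLanguage.{u}} {M : SortedStructure L} {κ : Cardinal.{u}}

/-- The real elements of a parameter set together with representatives of its hyperimaginaries
form a small set, and fixing it pointwise implies fixing the parameters. -/
theorem exists_small_real (hκ : ℵ₀ ≤ κ) (A : Params M κ) :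
    ∃ C : Set M.Elem, #C < κ ∧ ∀ g : M.Aut, g.Fixes C → A.FixedBy g := by
  choose P a hX hE hh using fun h : A.hyp => A.over_re h.1 h.2
  choose x hx using fun h => (P h).exists_rep (a h)
  let f : (Σ h : A.hyp, Fin (P h).arity) → M.Elem := fun p => ⟨(P p.1).sort p.2, x p.1 p.2⟩
  have hf : #(Set.range f) < κ := by
    rcases finite_or_infinite A.hyp with hfin | hinf
    · exact (Set.finite_range f).lt_aleph0.trans_le hκ
    -- Arities are finite, so the coordinates of the representatives embed in `A.hyp × ℕ`.
    · have hinj : Function.Injective fun p : (Σ h : A.hyp, Fin (P h).arity) => (p.1, p.2.1) := by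
        rintro ⟨h, i⟩ ⟨h', i'⟩ heq
        obtain ⟨rfl, hi⟩ := Prod.mk.inj heq
        exact congrArg (Sigma.mk h) (Fin.ext hi)
      refine (mk_range_le.trans (mk_le_of_injective hinj)).trans_lt ?_
      simpa [mul_aleph0_eq (aleph0_le_mk A.hyp)] using A.small_hyp
  refine ⟨A.re ∪ Set.range f, small_union hκ A.small_re hf, fun g hg => ?_⟩
  have hre : g.Fixes A.re := hg.mono Set.subset_union_left
  refine ⟨hre, fun h hmem => ?_⟩
  have key : ∀ g : M.Aut, g.Fixes (A.re ∪ Set.range f) → ∀ y, (P ⟨h, hmem⟩).Rep y (a ⟨h, hmem⟩) →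
      (P ⟨h, hmem⟩).Rep (g.app y) (a ⟨h, hmem⟩) := by
    intro g hg y hy
    have hmem' := (hE ⟨h, hmem⟩).app_mem (hg.mono Set.subset_union_left)
      (HyperdefinableSet.pairTuple_mem_graphE_iff.2 ⟨_, hx ⟨h, hmem⟩, hy⟩)
    have hgx : g.app (x ⟨h, hmem⟩) = x ⟨h, hmem⟩ :=
      funext fun i => hg _ (Or.inr ⟨⟨⟨h, hmem⟩, i⟩, rfl⟩)
    rw [g.app_pairTuple, hgx] at hmem'
    obtain ⟨b, hb, hy'⟩ := HyperdefinableSet.pairTuple_mem_graphE_iff.1 hmem'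
    exact (hx ⟨h, hmem⟩).unique hb ▸ hy'
  have hh := hh ⟨h, hmem⟩
  dsimp only at hh
  generalize (P ⟨h, hmem⟩) = P', a ⟨h, hmem⟩ = a' at hh key
  subst hh
  refine subset_antisymm ?_ fun y hy => ⟨g.symm.app y, key _ hg.symm y hy, g.app_symm_app y⟩
  rintro _ ⟨y, hy, rfl⟩
  exact key g hg y hy

end Params

/-! ### The logic topology: closed and compact pieces, comparison of topologies. -/

open Topology

namespace PiecewiseSystem

variable {L : SortedLanguage.{u}} {M : SortedStructure L} {κ : Cardinal.{u}}
  {P : PiecewiseSystem M κ}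

theorem incl_injective (i : P.I) : Function.Injective (P.incl i) :=
  DirectLimit.mk_injective P.map (fun i j h => (P.map i j h).injective) i

theorem incl_map {i j : P.I} (h : i ≤ j) (a : (P.piece i).Carrier) :
    P.incl j (P.map i j h a) = P.incl i a :=
  DirectLimit.mk_apply (F := fun i => (P.piece i).Carrier) (f := P.map) i j a h

theorem exists_incl (p : P.Carrier) : ∃ i a, P.incl i a = p := by
  obtain ⟨⟨i, a⟩, h⟩ := Quotient.exists_rep p
  exact ⟨i, a, h⟩

theorem pieceSet_mono {i j : P.I} (h : i ≤ j) : P.pieceSet i ⊆ P.pieceSet j := by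
  rintro _ ⟨a, rfl⟩
  exact ⟨_, incl_map h a⟩

section Topology

variable [t : TopologicalSpace P.Carrier] {A : Params M κ}

theorem IsLogicTopologyOver.typeDefinable_of_isClosed (hA : P.IsLogicTopologyOver A t)
    {V : Set P.Carrier} (hV : IsClosed V) (i : P.I) :
    TypeDefinable κ ((P.piece i).pre (P.incl i ⁻¹' V)) :=
  ((hA.2 V).1 hV i).1

/-- In a `T₁` logic topology over `A` every point is `A`-invariant, so that invariance may be
dropped from the definition of closed sets. -/
theorem IsLogicTopologyOver.isClosed_of_typeDefinable [T1Space P.Carrier]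
    (hA : P.IsLogicTopologyOver A t) {V : Set P.Carrier}
    (hV : ∀ i, TypeDefinable κ ((P.piece i).pre (P.incl i ⁻¹' V))) : IsClosed V := by
  refine (hA.2 V).2 fun i => ⟨hV i, fun g hg x ⟨a, ha, hx⟩ => ?_⟩
  -- Invariance of the closed point says that `g` moves a representative of `a` within its class.
  have hinv := ((hA.2 {P.incl i a}).1 isClosed_singleton i).2
  have hpre : P.incl i ⁻¹' {P.incl i a} = {a} := by
    ext b
    simp [(incl_injective i).eq_iff]
  rw [hpre] at hinv
  have hgx := hinv g hg x (HyperdefinableSet.mem_pre_singleton_iff.2 hx)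
  exact ⟨a, ha, HyperdefinableSet.mem_pre_singleton_iff.1 hgx⟩

variable (hκ : ℵ₀ ≤ κ) (hsat : M.Saturated κ) (hhom : M.StronglyHomogeneous κ)
include hκ hsat hhom

/-- The trace on piece `j` is computed in a common larger piece `k`: push forward from `i`, then
pull back to `j`. -/
theorem IsLogicTopologyOver.isClosed_image_incl [T1Space P.Carrier]
    (hA : P.IsLogicTopologyOver A t) {i : P.I} {V : Set (P.piece i).Carrier}
    (hV : TypeDefinable κ ((P.piece i).pre V)) : IsClosed (P.incl i '' V) := by
  refine hA.isClosed_of_typeDefinable fun j => ?_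
  obtain ⟨k, hik, hjk⟩ := exists_ge_ge i j
  have h := HyperdefinableSet.typeDefinable_pre_exists hκ hsat hhom (hA.1.2 j k hjk).1
    (HyperdefinableSet.typeDefinable_pre_exists_left hκ hsat hhom (hA.1.2 i k hik).1 hV)
  convert h using 2
  ext b
  constructor
  · rintro ⟨a, ha, hab⟩
    refine ⟨_, ⟨a, ha, rfl⟩, ?_⟩
    exact incl_injective k (by rw [incl_map, incl_map, hab])
  · rintro ⟨_, ⟨a, ha, rfl⟩, hab⟩
    exact ⟨a, ha, by rw [← incl_map hik, ← incl_map hjk, hab]⟩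

theorem IsLogicTopologyOver.isClosed_pieceSet [T1Space P.Carrier]
    (hA : P.IsLogicTopologyOver A t) (i : P.I) : IsClosed (P.pieceSet i) := by
  rw [pieceSet, ← Set.image_univ]
  refine hA.isClosed_image_incl hκ hsat hhom ?_
  rw [HyperdefinableSet.pre_univ]
  exact (P.piece i).typeDefinable_X

theorem IsLogicTopologyOver.isCompact_pieceSet (hA : P.IsLogicTopologyOver A t) (i : P.I) :
    IsCompact (P.pieceSet i) := by
  obtain ⟨C, hC, hCA⟩ := A.exists_small_real hκ
  refine isCompact_of_finite_subfamily_closed fun {ι} Z hZ hemp => ?_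
  by_contra! hne
  have hdef : ∀ V : Set (M.Tuple (P.piece i).sort), A.TypeDef V → TypeDefinableOver C V :=
    fun V hV => hV.1.typeDefinableOver hκ hsat hhom hC fun g hg => hV.2 g (hCA g hg)
  -- The extra index `none` stands for `X` itself, so that the realisation represents a point of the
  -- piece even when `ι` is empty.
  obtain ⟨x, hx⟩ := hsat.nonempty_iInter hC (ι := Option ι)
    (V := fun o => o.elim (P.piece i).X fun z => (P.piece i).pre (P.incl i ⁻¹' Z z))
    (by
      rintro (_ | z)
      · exact hdef _ (hA.1.1 i).1
      · exact hdef _ ((hA.2 _).1 (hZ z) i))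
    (fun s => by
      obtain ⟨_, ⟨a, rfl⟩, ha⟩ := hne s.eraseNone
      obtain ⟨x, hx⟩ := (P.piece i).exists_rep a
      refine ⟨x, Set.mem_iInter₂.2 ?_⟩
      rintro (_ | z) hz
      · exact hx.1
      · exact ⟨a, Set.mem_iInter₂.1 ha z (Finset.mem_eraseNone.2 hz), hx⟩)
  rw [Set.mem_iInter] at hx
  obtain ⟨a, ha⟩ : ∃ a, (P.piece i).Rep x a := ⟨_, hx none, rfl⟩
  refine Set.eq_empty_iff_forall_notMem.1 hemp (P.incl i a) ⟨⟨a, rfl⟩, Set.mem_iInter.2 fun z => ?_⟩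
  exact (ha.mem_pre_iff (V := P.incl i ⁻¹' Z z)).1 (hx (some z))

theorem IsLogicTopologyOver.locallyCompactSpace [R1Space P.Carrier]
    (hA : P.IsLogicTopologyOver A t) (hloc : ∀ p, ∃ i, P.pieceSet i ∈ 𝓝 p) :
    LocallyCompactSpace P.Carrier := by
  have : WeaklyLocallyCompactSpace P.Carrier :=
    ⟨fun p => (hloc p).imp' _ fun i hi => ⟨hA.isCompact_pieceSet hκ hsat hhom i, hi⟩⟩
  infer_instance

end Topology

/-- A `T₁` logic topology is the finest logic topology. -/
theorem IsGlobalLogicTopology.le {t t' : TopologicalSpace P.Carrier} (h : P.IsGlobalLogicTopology t)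
    (h' : P.IsLogicTopology t') : t ≤ t' := by
  obtain ⟨A', hA'⟩ := h'
  have hdef (U : Set P.Carrier) (hU : IsOpen[t'] U) (i : P.I) :=
    ((hA'.2 Uᶜ).1 ((@isClosed_compl_iff _ t' U).2 hU) i).1
  clear hA'
  obtain ⟨⟨A, hA⟩, hT1⟩ := h
  exact fun U hU => (@isClosed_compl_iff _ t U).1 <|
    @IsLogicTopologyOver.isClosed_of_typeDefinable _ _ _ P t A hT1 hA _ (hdef U hU)

end PiecewiseSystem

/-! ### Continuity of the group operations and local compactness. -/

namespace PiecewiseSystem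

variable {L : SortedLanguage.{u}} {M : SortedStructure L} {κ : Cardinal.{u}}
  {P : PiecewiseSystem M κ} [Group P.Carrier] [t : TopologicalSpace P.Carrier]

section Saturation

variable [T1Space P.Carrier] (hκ : ℵ₀ ≤ κ) (hsat : M.Saturated κ)
  (hhom : M.StronglyHomogeneous κ)
include hκ hsat hhom

theorem IsHyperdefinableGroup.continuousMul (hG : P.IsHyperdefinableGroup) {A : Params M κ}
    (hA : P.IsLogicTopologyOver A t) (hloc : ∀ p, ∃ i, P.pieceSet i ∈ 𝓝 p) :
    ContinuousMul P.Carrier := by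
  obtain ⟨A', -, hmul, hbdd, -, -⟩ := hG
  refine ⟨continuous_iff_continuousAt.2 ?_⟩
  rintro ⟨g, h⟩ N hN
  obtain ⟨O, hON, hO, hgh⟩ := mem_nhds_iff.1 hN
  obtain ⟨i, hi⟩ := hloc g
  obtain ⟨j, hj⟩ := hloc h
  obtain ⟨k, hk⟩ := hbdd i j
  obtain ⟨a, rfl⟩ := mem_of_mem_nhds hi
  obtain ⟨b, rfl⟩ := mem_of_mem_nhds hj
  -- The relation holds when the product is a point of piece `k` off `O`. Products from pieces `i`
  -- and `j` stay in piece `k`, so where it fails the product lies in `O`.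
  obtain ⟨V, W, hV, hW, haV, hbW, hVW⟩ := HyperdefinableSet.exists_box hκ hsat hhom
    (HyperdefinableSet.typeDefinable_pre₂_exists hκ hsat hhom (hmul i j k).1
      (hA.typeDefinable_of_isClosed hO.isClosed_compl k))
    (a := a) (b := b) (by
      rintro ⟨c, hc, habc⟩
      exact hc (habc ▸ hgh))
  have hV' : (P.incl i '' V)ᶜ ∈ 𝓝 (P.incl i a) :=
    (hA.isClosed_image_incl hκ hsat hhom hV).isOpen_compl.mem_nhds
      (by rwa [Set.mem_compl_iff, (incl_injective i).mem_set_image])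
  have hW' : (P.incl j '' W)ᶜ ∈ 𝓝 (P.incl j b) :=
    (hA.isClosed_image_incl hκ hsat hhom hW).isOpen_compl.mem_nhds
      (by rwa [Set.mem_compl_iff, (incl_injective j).mem_set_image])
  rw [Filter.mem_map]
  filter_upwards [prod_mem_nhds (Filter.inter_mem hi hV') (Filter.inter_mem hj hW')]
  rintro ⟨_, _⟩ ⟨⟨⟨a', rfl⟩, ha'⟩, ⟨b', rfl⟩, hb'⟩
  rw [Set.mem_compl_iff, (incl_injective _).mem_set_image] at ha' hb'
  refine hON ?_
  by_contra hO'
  obtain ⟨c, hc⟩ := hk _ ⟨a', rfl⟩ _ ⟨b', rfl⟩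
  rcases hVW a' b' ⟨c, by rwa [Set.mem_preimage, hc], hc.symm⟩ with h | h
  exacts [ha' h, hb' h]

theorem IsHyperdefinableGroup.continuousInv (hG : P.IsHyperdefinableGroup) {A : Params M κ}
    (hA : P.IsLogicTopologyOver A t) : ContinuousInv P.Carrier := by
  obtain ⟨A', -, -, -, hinv, hbdd⟩ := hG
  refine ⟨continuous_iff_isClosed.2 fun V hV => hA.isClosed_of_typeDefinable fun i => ?_⟩
  obtain ⟨j, hj⟩ := hbdd i
  convert HyperdefinableSet.typeDefinable_pre_exists hκ hsat hhom (hinv i j).1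
    (hA.typeDefinable_of_isClosed hV j) using 2
  ext a
  constructor
  · intro ha
    obtain ⟨b, hb⟩ := hj _ ⟨a, rfl⟩
    exact ⟨b, by rwa [Set.mem_preimage, hb], hb.symm⟩
  · rintro ⟨b, hb, hab⟩
    rwa [Set.mem_preimage, Set.mem_preimage, hab]

end Saturation

theorem IsHyperdefinableGroup.isLocallyCompactTopologicalGroup (hκ : ℵ₀ ≤ κ)
    (hsat : M.Saturated κ) (hhom : M.StronglyHomogeneous κ) (hG : P.IsHyperdefinableGroup)
    (hloc : P.IsLocallyHyperdefinable) (ht : P.IsGlobalLogicTopology t) :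
    IsLocallyCompactTopologicalGroup P.Carrier t := by
  replace hloc : ∀ p, ∃ i, P.pieceSet i ∈ 𝓝 p := by
    obtain ⟨t', ht', hloc⟩ := hloc
    -- The topology witnessing local hyperdefinability may differ from `t`, but `t` is finer.
    exact fun p => (hloc p).imp fun i hi => nhds_mono (ht.le ht') hi
  obtain ⟨⟨A, hA⟩, hT1⟩ := ht
  have := hG.continuousMul hκ hsat hhom hA hloc
  have := hG.continuousInv hκ hsat hhom hA
  have hgrp : IsTopologicalGroup P.Carrier := ⟨⟩
  exact ⟨inferInstance, hgrp, hA.locallyCompactSpace hκ hsat hhom hloc⟩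

/-- A locally compact topology on a countable union of closed pieces makes some piece a
neighbourhood of a point, and then translation makes some piece a neighbourhood of any point. -/
theorem IsHyperdefinableGroup.exists_pieceSet_mem_nhds [T2Space P.Carrier]
    [IsTopologicalGroup P.Carrier] [LocallyCompactSpace P.Carrier]
    (hG : P.IsHyperdefinableGroup) (hcount : P.IsCountablyPiecewise)
    (hclosed : ∀ i, IsClosed (P.pieceSet i)) (p : P.Carrier) : ∃ i, P.pieceSet i ∈ 𝓝 p := by
  obtain ⟨A, -, -, hbdd, -, -⟩ := hG
  obtain ⟨s, hs, hcard⟩ := Order.exists_cof_eq P.I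
  have : Countable s := mk_le_aleph0_iff.1 (hcard ▸ hcount)
  obtain ⟨i, q, hq⟩ := nonempty_interior_of_iUnion_of_closed (f := fun i : s => P.pieceSet i)
    (fun i => hclosed i) (by
      refine Set.eq_univ_of_forall fun p => ?_
      obtain ⟨i, a, rfl⟩ := exists_incl p
      obtain ⟨j, hj, hij⟩ := hs i
      exact Set.mem_iUnion.2 ⟨⟨j, hj⟩, pieceSet_mono hij ⟨a, rfl⟩⟩)
  -- Left translation by `p * q⁻¹` sends the interior point `q` to `p`, and sends piece `i` into a
  -- piece `k`.
  obtain ⟨j, a, ha⟩ := exists_incl (p * q⁻¹)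
  obtain ⟨k, hk⟩ := hbdd j i
  refine ⟨k, ?_⟩
  have hnhds : P.pieceSet i ∈ 𝓝 ((p * q⁻¹)⁻¹ * p) := by
    rw [show (p * q⁻¹)⁻¹ * p = q by group]
    exact mem_interior_iff_mem_nhds.1 hq
  filter_upwards [(continuous_const_mul (p * q⁻¹)⁻¹).continuousAt.preimage_mem_nhds hnhds] with r hr
  have := hk (p * q⁻¹) ⟨a, ha⟩ _ hr
  rwa [mul_inv_cancel_left] at this

end PiecewiseSystem

theorem theoremt {L : SortedLanguage.{u}} (M : SortedStructure L) (κ : Cardinal.{u})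
    (hκ : κ.IsStrongLimit) (hL : L.card < κ) (hM : Infinite M.Elem)
    (hsat : M.Saturated κ) (hhom : M.StronglyHomogeneous κ)
    (G : PiecewiseSystem M κ) [Group G.Carrier] (hG : G.IsHyperdefinableGroup) :
    (G.IsLocallyHyperdefinable → ∀ t : TopologicalSpace G.Carrier, G.IsGlobalLogicTopology t →
      IsLocallyCompactTopologicalGroup G.Carrier t) ∧
    (G.IsCountablyPiecewise → ∀ t : TopologicalSpace G.Carrier, G.IsLogicTopology t →
      (IsLocallyCompactTopologicalGroup G.Carrier t ↔
        G.IsGlobalLogicTopology t ∧ G.IsLocallyHyperdefinable)) := by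
  refine ⟨fun hloc t ht => hG.isLocallyCompactTopologicalGroup hκ.aleph0_le hsat hhom hloc ht,
    fun hcount t ht => ⟨fun ⟨hT2, hgrp, hlc⟩ => ?_, fun ⟨ht, hloc⟩ =>
      hG.isLocallyCompactTopologicalGroup hκ.aleph0_le hsat hhom hloc ht⟩⟩
  refine ⟨⟨ht, inferInstance⟩, t, ht, hG.exists_pieceSet_mem_nhds hcount fun i => ?_⟩
  obtain ⟨A, hA⟩ := ht
  exact hA.isClosed_pieceSet hκ.aleph0_le hsat hhom i
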